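/- **Setting.** An instance of the sorting problem with uncertainty consists of closed intervals $I_i=[\ell_i,r_i]$ ($i=1,\dots,n$), query costs $w_i\ge 0$ and an error threshold $\delta\ge 0$; there are unknown values $v_i\in I_i$. Querying $i$ costs $w_i$ and reveals $v_i$, after which $I_i$ is replaced by $[v_i,v_i]$. The goal is a permutation $\pi$ of $\{1,\dots,n\}$ such that $v_i\le v_j+\delta$ whenever $\pi(i)<\pi(j)$. Query costs are uniform if $w_1=\dots=w_n$. An offline query set for $v$ is a set $Q$ of items for which some permutation $\pi$ is acceptable for all $u$ with $u_i\in I_i$ for all $i$ and $u_i=v_i$ for $i\in Q$; $\mathrm{opt}(v)$ is the minimum total cost of such a set. A deterministic adaptive algorithm chooses each query (and finally the permutation) from the intervals, costs, $\delta$ and the answers received so far; a randomized adaptive algorithm is a probability distribution over deterministic ones. It solves an instance if for all consistent values $v$ it almost surely outputs an acceptable permutation, and its expected query-competitive ratio is at most $\alpha$ if, for every instance and every consistent $v$ (fixed independently of the random choices), the expected total query cost is at most $\alpha\cdot\mathrm{opt}(v)$. Distinct items $i,j$ are dependent if $r_i-\ell_j>\delta$ and $r_j-\ell_i>\delta$;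 this defines the dependency graph of the current intervals. Write $I_i\supset[a,b]$ if $\ell_i<a$ and $b<r_i$. **Algorithm 1** (parameter $p\in[0,1]$; $\mathcal V$ is the set of values revealed so far; all intervals are the current ones; choices and ties not specified are resolved arbitrarily, possibly depending on what has been observed so far): 1. While there are $i,j$ with $I_i\supset[\ell_j-\delta,r_j+\delta]$, or $I_i\supset[v_j-\delta,v_j+\delta]$ with $v_j\in\mathcal V$: query $i$. 2. While there is a dependent pair: - (a) If some connected component of the dependency graph is a single edge $ij$: by an independent coin, let $i$ be picked with probability $p$ and $j$ with probability $1-p$; say $i$ is picked. Query $i$; if then $I_j\supset[v_i-\delta,v_i+\delta]$, query $j$. - (b) Otherwise let $x$ be a non-isolated vertex with minimum $r_x$, $y$ a neighbour of $x$ with minimum $r_y$, and $z$ another neighbour of $x$ (of $y$, different from $x$, if $y$ is the only neighbour of $x$) with minimum $r_z$. Query $y$. If then $I_x\supset[v_y-\delta,v_y+\delta]$, or $x$ and $z$ are dependent, query $x$ and $z$. - (c) While there is $i$ with $I_i\supset[v_j-\delta,v_j+\delta]$ for some $v_j\in\mathcal V$: query $i$. 3. Output a permutation $\pi$ with $r_i\le\ell_j+\delta$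 whenever $\pi(i)<\pi(j)$. **Theorem.** Let $\delta\ge 0$ and $c>0$, and consider the instances with error threshold $\delta$ in which every query costs $c$. (i) For $p=1/2$, and for every way of resolving the unspecified choices, Algorithm 1 is a randomized adaptive algorithm that solves all these instances and has expected query-competitive ratio at most $3/2$ on them. (ii) If any randomized adaptive algorithm solves all these instances and has expected query-competitive ratio at most $\alpha$ on them, then $\alpha\ge 3/2$. In particular, the ratio in (i) is exactly $3/2$ and best possible. -/

import Mathlib

open MeasureTheory ProbabilityTheory
open scoped NNReal ENNReal

noncomputable section

namespace SortingQueries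

/-- The data of the sorting problem with uncertainty that an algorithm sees: `n` closed intervals
`[lo i, hi i]`, query costs and an error threshold. -/
structure Instance where
  n : ℕ
  lo : Fin n → ℝ
  hi : Fin n → ℝ
  lo_le_hi : ∀ i, lo i ≤ hi i
  cost : Fin n → ℝ≥0
  δ : ℝ
  δ_nonneg : 0 ≤ δ

/-- The vectors of actual values that are consistent with the intervals. -/
def Instance.values (I : Instance) : Set (Fin I.n → ℝ) :=
  {v | ∀ i, v i ∈ Set.Icc (I.lo i) (I.hi i)}

/-- `π` (position of each item) is an acceptable ordering for the values `v`: whenever `i` is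
placed before `j`, `v i ≤ v j + δ`. -/
def Instance.IsOrdering (I : Instance) (π : Equiv.Perm (Fin I.n)) (v : Fin I.n → ℝ) : Prop :=
  ∀ i j, π i < π j → v i ≤ v j + I.δ

/-! ### Offline optimum -/

/-- Querying the items in `Q` proves some ordering when the actual values are `v`: the ordering is
acceptable for all value vectors that agree with the intervals and with the answers to `Q`. -/
def Instance.IsQuerySet (I : Instance) (v : Fin I.n → ℝ) (Q : Finset (Fin I.n)) : Prop :=
  ∃ π : Equiv.Perm (Fin I.n), ∀ u ∈ I.values, (∀ i ∈ Q, u i = v i) → I.IsOrdering π u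

/-- The cost of an offline optimum query set. -/
def Instance.opt (I : Instance) (v : Fin I.n → ℝ) : ℝ≥0∞ :=
  ⨅ (Q : Finset (Fin I.n)) (_ : I.IsQuerySet v Q), ∑ i ∈ Q, (I.cost i : ℝ≥0∞)

/-! ### Deterministic and randomized adaptive algorithms -/

/-- A deterministic adaptive algorithm for `n` items: it either outputs an ordering, or queries an
item and continues depending on the value that the query reveals. -/
inductive QueryTree (n : ℕ) : Type
  | output (π : Equiv.Perm (Fin n)) : QueryTree n
  | query (i : Fin n) (next : ℝ → QueryTree n) : QueryTree n

/-- The list of queries that are made when the actual values are `v`. -/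
def QueryTree.queries {n : ℕ} : QueryTree n → (Fin n → ℝ) → List (Fin n)
  | .output _, _ => []
  | .query i next, v => i :: (next (v i)).queries v

/-- The ordering that is output when the actual values are `v`. -/
def QueryTree.result {n : ℕ} : QueryTree n → (Fin n → ℝ) → Equiv.Perm (Fin n)
  | .output π, _ => π
  | .query i next, v => (next (v i)).result v

/-- A probability distribution over deterministic adaptive algorithms, given by a random seed. -/
structure RandomizedStrategy (n : ℕ) where
  Ω : Type
  [mΩ : MeasurableSpace Ω]
  μ : Measure Ω
  [isProb : IsProbabilityMeasure μ]
  tree : Ω → QueryTree n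
  measurable_queries : ∀ (v : Fin n → ℝ) (l : List (Fin n)),
    MeasurableSet {ω | (tree ω).queries v = l}

attribute [instance] RandomizedStrategy.mΩ RandomizedStrategy.isProb

/-- A randomized adaptive algorithm chooses its strategy knowing the intervals, the query costs
and the threshold, but not the actual values. -/
def RandomizedAlgorithm : Type 1 := (I : Instance) → RandomizedStrategy I.n

/-- The expected total query cost of `A` on the instance `I` with actual values `v`, which are
fixed independently of the seed (oblivious adversary). -/
def RandomizedAlgorithm.expectedCost (A : RandomizedAlgorithm) (I : Instance)
    (v : Fin I.n → ℝ) : ℝ≥0∞ :=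
  ∫⁻ ω, ((((A I).tree ω).queries v).map fun i => (I.cost i : ℝ≥0∞)).sum ∂(A I).μ

/-- `A` solves all instances of the class `S`: for all actual values, it almost surely outputs an
acceptable ordering. -/
def RandomizedAlgorithm.SolvesOn (A : RandomizedAlgorithm) (S : Set Instance) : Prop :=
  ∀ I ∈ S, ∀ v ∈ I.values, ∀ᵐ ω ∂(A I).μ, I.IsOrdering (((A I).tree ω).result v) v

/-- On all instances of the class `S` the expected cost of `A` is at most `α` times that of an
offline optimum query set. -/
def RandomizedAlgorithm.IsCompetitiveOn (A : RandomizedAlgorithm) (S : Set Instance)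
    (α : ℝ≥0) : Prop :=
  ∀ I ∈ S, ∀ v ∈ I.values, A.expectedCost I v ≤ α * I.opt v

/-- The instances with error threshold `δ` in which every query has the same cost `c`. -/
def uniformInstances (δ : ℝ) (c : ℝ≥0) : Set Instance :=
  {I | I.δ = δ ∧ ∀ i, I.cost i = c}

/-! ### The current intervals and their dependency graph -/

/-- The queries made so far with their answers, the latest one first. -/
abbrev Transcript (n : ℕ) : Type := List (Fin n × ℝ)

namespace Instance

variable (I : Instance) (s : Transcript I.n)

/-- Left endpoint of the current interval: a queried interval is replaced by `[v i, v i]`. -/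
def curLo (i : Fin I.n) : ℝ := (s.lookup i).getD (I.lo i)

/-- Right endpoint of the current interval. -/
def curHi (i : Fin I.n) : ℝ := (s.lookup i).getD (I.hi i)

/-- The current interval of `i` strictly contains `[a, b]`, at both ends. -/
def StrictlyContains (i : Fin I.n) (a b : ℝ) : Prop := I.curLo s i < a ∧ b < I.curHi s i

/-- The dependency graph of the current intervals. -/
def depGraph : SimpleGraph (Fin I.n) where
  Adj i j := i ≠ j ∧ I.curHi s i - I.curLo s j > I.δ ∧ I.curHi s j - I.curLo s i > I.δ
  symm := ⟨fun _ _ h => ⟨h.1.symm, h.2.2, h.2.1⟩⟩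

/-- The current interval of `i` strictly contains `[v - δ, v + δ]` for some revealed value `v`. -/
def IsForcedByValue (i : Fin I.n) : Prop :=
  ∃ a ∈ s, I.StrictlyContains s i (a.2 - I.δ) (a.2 + I.δ)

/-- The current interval of `i` strictly contains the `δ`-neighbourhood of another current
interval, or of some revealed value. -/
def IsForced (i : Fin I.n) : Prop :=
  (∃ j, I.StrictlyContains s i (I.curLo s j - I.δ) (I.curHi s j + I.δ)) ∨ I.IsForcedByValue s i

/-- `i` and `j` form a connected component of the dependency graph with exactly two vertices. -/
def IsEdgeComponent (i j : Fin I.n) : Prop :=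
  (I.depGraph s).neighborSet i = {j} ∧ (I.depGraph s).neighborSet j = {i}

/-- `x` has minimum current right endpoint among the items satisfying `P`. -/
def IsMinRight (P : Fin I.n → Prop) (x : Fin I.n) : Prop :=
  P x ∧ ∀ k, P k → I.curHi s x ≤ I.curHi s k

/-- `x` is a non-isolated vertex with minimum right endpoint, `y` is a neighbour of `x` with
minimum right endpoint, and `z` is another neighbour of `x` (of `y` if `x` is a leaf) with minimum
right endpoint. -/
def IsTriple (x y z : Fin I.n) : Prop :=
  I.IsMinRight s (fun k => ∃ l, (I.depGraph s).Adj k l) x ∧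
  I.IsMinRight s (fun k => (I.depGraph s).Adj x k) y ∧
  (((I.depGraph s).neighborSet x ≠ {y} ∧
      I.IsMinRight s (fun k => (I.depGraph s).Adj x k ∧ k ≠ y) z) ∨
    ((I.depGraph s).neighborSet x = {y} ∧
      I.IsMinRight s (fun k => (I.depGraph s).Adj y k ∧ k ≠ x) z))

/-- The ordering `π` is certified by the current intervals. -/
def IsCertified (π : Equiv.Perm (Fin I.n)) : Prop :=
  ∀ i j, π i < π j → I.curHi s i ≤ I.curLo s j + I.δ

end Instance

/-! ### The algorithm -/

/-- A way to pick an element of each nonempty finite set. -/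
abbrev Selector (α : Type) : Type := (S : Finset α) → S.Nonempty → {a : α // a ∈ S}

/-- The choices that the algorithm leaves open; they may depend on everything observed so far. -/
structure TieBreaking (n : ℕ) where
  forced : Transcript n → Selector (Fin n)
  edge : Transcript n → Selector (Fin n × Fin n)
  triple : Transcript n → Selector (Fin n × Fin n × Fin n)
  ordering : Transcript n → Selector (Equiv.Perm (Fin n))

namespace Instance

variable (I : Instance) (tb : TieBreaking I.n)

open Classical in
/-- `while there is i with P i: query i`, followed by `k`. The first argument bounds the number of
iterations. -/
def whileForced (P : Transcript I.n → Fin I.n → Prop) :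
    ℕ → Transcript I.n → (Transcript I.n → QueryTree I.n) → QueryTree I.n
  | 0, s, k => k s
  | m + 1, s, k =>
    if h : (Finset.univ.filter (P s)).Nonempty then
      let i := (tb.forced s _ h).1
      .query i fun v => whileForced P m ((i, v) :: s) k
    else k s

open Classical in
/-- Output some ordering that is certified by the current intervals. -/
def finish (s : Transcript I.n) : QueryTree I.n :=
  if h : (Finset.univ.filter (I.IsCertified s)).Nonempty then .output (tb.ordering s _ h).1
  else .output 1

open Classical in
/-- The main loop, `while there is some dependency`, with one coin for each of its iterations; the
number of coins bounds the number of iterations. On an edge component, the selected pair `(i, j)`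
is used as it is if the coin shows `true`, and with `i` and `j` exchanged otherwise. -/
def mainLoop : (m : ℕ) → (Fin m → Bool) → Transcript I.n → QueryTree I.n
  | 0, _, s => I.finish tb s
  | m + 1, coin, s =>
    let next : Transcript I.n → QueryTree I.n := fun s' =>
      I.whileForced tb I.IsForcedByValue I.n s' (mainLoop m (Fin.tail coin))
    if ∃ i j, (I.depGraph s).Adj i j then
      if he : (Finset.univ.filter fun e : Fin I.n × Fin I.n =>
          I.IsEdgeComponent s e.1 e.2).Nonempty then
        let e := (tb.edge s _ he).1
        let i := if coin 0 then e.1 else e.2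
        let j := if coin 0 then e.2 else e.1
        .query i fun vi =>
          let s₁ := (i, vi) :: s
          if I.StrictlyContains s₁ j (vi - I.δ) (vi + I.δ) then
            .query j fun vj => next ((j, vj) :: s₁)
          else next s₁
      else if ht : (Finset.univ.filter fun t : Fin I.n × Fin I.n × Fin I.n =>
          I.IsTriple s t.1 t.2.1 t.2.2).Nonempty then
        let t := (tb.triple s _ ht).1
        let x := t.1
        let y := t.2.1
        let z := t.2.2
        .query y fun vy =>
          let s₁ := (y, vy) :: s
          if I.StrictlyContains s₁ x (vy - I.δ) (vy + I.δ) ∨ (I.depGraph s₁).Adj x z then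
            .query x fun vx => .query z fun vz => next ((z, vz) :: (x, vx) :: s₁)
          else next s₁
      else I.finish tb s
    else I.finish tb s

/-- The algorithm for given outcomes of the coins. Each iteration of each of its loops queries an
interval that was not queried before, so `n` iterations suffice for each loop. -/
def adaptiveTree (coin : Fin I.n → Bool) : QueryTree I.n :=
  I.whileForced tb I.IsForced I.n [] (I.mainLoop tb I.n coin)

end Instance

/-- The improved adaptive algorithm with parameter `p`: independent coins that show `true` with
probability `p`. -/
def improvedAdaptive (p : unitInterval) (tb : (I : Instance) → TieBreaking I.n) :
    RandomizedAlgorithm := fun I =>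
  { Ω := Fin I.n → Bool
    μ := Measure.pi fun _ => bernoulliMeasure true false p
    tree := I.adaptiveTree (tb I)
    measurable_queries := fun _ _ => (Set.toFinite _).measurableSet }

end SortingQueries

end

/-!
# Sorting with uncertain values: the randomized ratio is `3 / 2`

*Upper bound.* Fix the actual values `v` and an offline query set `Q`. If two possible value vectors
that agree with `v` on `Q` put two items more than `δ` apart in opposite orders, then `Q` proves no
ordering (`IsQuerySet.not_both_orders`). Hence `Q` contains an end of every dependency between
unqueried items (`mem_or_mem_of_adj`), and it contains every item whose interval strictly contains
the `δ`-neighbourhood of another current interval or of a revealed value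
(`active_and_mem_of_contains_cur`). The analysis is a potential argument: the `potential` of a
transcript is the number of unqueried items of `Q` that still have a dependency, and the expected
number of further queries is at most `3 / 2` times the potential.

* Queries to forced items lie in `Q`, so every `while` loop pays for itself
  (`exists_whileForced_leadsTo`).
* A round on an edge component `{i, j}` removes both items. If `Q` contains both, then it costs at
  most `2`; if `Q` contains exactly one, then starting with this one costs `1` and starting with the
  other one costs at most `2`, so the fair coin gives `3 / 2` (`exists_edgeRound_leadsTo`).
* A round on a triple costs `3` only if `Q` contains two of its items, because then either `x` is
  forced and `yz` is a dependency, or, by the choice of the right endpoints, the three items form a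
  triangle (`IsTriple.adj_y_z`). Otherwise a single query removes `x` and `y`, of which `Q` contains
  one (`exists_tripleRound_leadsTo`).

Expectations over `m` fair coins are handled as sums of natural numbers over `Fin m → Bool`
(`sum_mainLoop_length_le`). When no dependency is left, sorting by the midpoints of the current
intervals is a certified ordering (`exists_isCertified`).

*Lower bound.* For two copies of `[0, 2δ + 2]`, let one item have value `0` and the other the
midpoint value `δ + 1`. The item of value `0` must be queried, and querying it alone suffices. The
item that a deterministic algorithm queries first is the wrong one in one of the two cases, so its
costs in the two cases add up to at least three queries (`three_le_length_add_length`).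
-/

namespace SortingQueries

/-! ### Transcripts -/

/-- The answers recorded in a transcript are those given by the actual values `v`. -/
def Consistent {n : ℕ} (v : Fin n → ℝ) (s : Transcript n) : Prop := ∀ a ∈ s, a.2 = v a.1

/-- The item `i` occurs as a query in the transcript. -/
def Queried {n : ℕ} (s : Transcript n) (i : Fin n) : Prop := ∃ a ∈ s, a.1 = i

theorem consistent_nil {n : ℕ} {v : Fin n → ℝ} : Consistent v ([] : Transcript n) := by
  simp [Consistent]

theorem consistent_cons {n : ℕ} {v : Fin n → ℝ} {s : Transcript n} (hs : Consistent v s)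
    (i : Fin n) : Consistent v ((i, v i) :: s) := by
  simpa [Consistent] using hs

theorem queried_cons {n : ℕ} {s : Transcript n} {i k : Fin n} {a : ℝ} :
    Queried ((i, a) :: s) k ↔ i = k ∨ Queried s k := by
  simp [Queried]

namespace Instance

variable {I : Instance} {v : Fin I.n → ℝ} {s : Transcript I.n} {Q : Finset (Fin I.n)}

/-! ### Offline query sets -/

/-- If the values that remain possible after querying `Q` can put `i` more than `δ` above `j`, and
also `j` more than `δ` above `i`, then `Q` does not prove any ordering. -/
theorem IsQuerySet.not_both_orders (hQ : I.IsQuerySet v Q) {i j : Fin I.n} (hij : i ≠ j)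
    {u u' : Fin I.n → ℝ} (hu : u ∈ I.values) (hu' : u' ∈ I.values)
    (hQu : ∀ k ∈ Q, u k = v k) (hQu' : ∀ k ∈ Q, u' k = v k)
    (h : u j + I.δ < u i) : u' j ≤ u' i + I.δ := by
  obtain ⟨π, hπ⟩ := hQ
  rcases lt_or_gt_of_ne (π.injective.ne hij) with hlt | hlt
  · exact absurd (hπ u hu hQu i j hlt) (not_le.mpr h)
  · exact hπ u' hu' hQu' j i hlt

theorem values_update (hv : v ∈ I.values) {i : Fin I.n} {a : ℝ}
    (ha : a ∈ Set.Icc (I.lo i) (I.hi i)) :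
    Function.update v i a ∈ I.values := by
  intro k
  by_cases hk : k = i
  · subst hk; simpa using ha
  · simpa [hk] using hv k

theorem IsQuerySet.mem_of_contains_value (hQ : I.IsQuerySet v Q) (hv : v ∈ I.values)
    {i j : Fin I.n} (hij : i ≠ j) (hlo : I.lo i < v j - I.δ) (hhi : v j + I.δ < I.hi i) :
    i ∈ Q := by
  by_contra hi
  have hne : ∀ k ∈ Q, k ≠ i := fun k hk h => hi (h ▸ hk)
  have := hQ.not_both_orders hij
    (values_update hv (Set.right_mem_Icc.mpr (I.lo_le_hi i)))
    (values_update hv (Set.left_mem_Icc.mpr (I.lo_le_hi i)))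
    (fun k hk => by simp [hne k hk]) (fun k hk => by simp [hne k hk])
    (by simpa [hij.symm] using hhi)
  simp only [Function.update_self, Function.update_of_ne hij.symm] at this
  linarith

theorem IsQuerySet.mem_or_mem_of_dependent (hQ : I.IsQuerySet v Q) (hv : v ∈ I.values)
    {i j : Fin I.n} (hij : i ≠ j) (h₁ : I.hi i - I.lo j > I.δ) (h₂ : I.hi j - I.lo i > I.δ) :
    i ∈ Q ∨ j ∈ Q := by
  by_contra! hnot
  obtain ⟨hi, hj⟩ := hnot
  have hne : ∀ k ∈ Q, k ≠ i ∧ k ≠ j := fun k hk => ⟨fun h => hi (h ▸ hk), fun h => hj (h ▸ hk)⟩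
  have := hQ.not_both_orders hij
    (values_update (values_update hv (Set.left_mem_Icc.mpr (I.lo_le_hi j)))
      (Set.right_mem_Icc.mpr (I.lo_le_hi i)))
    (values_update (values_update hv (Set.right_mem_Icc.mpr (I.lo_le_hi j)))
      (Set.left_mem_Icc.mpr (I.lo_le_hi i)))
    (fun k hk => by simp [hne k hk]) (fun k hk => by simp [hne k hk])
    (by simp only [Function.update_self, Function.update_of_ne hij.symm]; linarith)
  simp only [Function.update_self, Function.update_of_ne hij.symm] at this
  linarith

/-! ### Current intervals -/

theorem curLo_cons (i k : Fin I.n) (a : ℝ) :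
    I.curLo ((i, a) :: s) k = if k = i then a else I.curLo s k := by
  unfold curLo
  by_cases h : k = i
  · simp [h]
  · simp [List.lookup_cons, beq_eq_false_iff_ne.mpr h, h]

theorem curHi_cons (i k : Fin I.n) (a : ℝ) :
    I.curHi ((i, a) :: s) k = if k = i then a else I.curHi s k := by
  unfold curHi
  by_cases h : k = i
  · simp [h]
  · simp [List.lookup_cons, beq_eq_false_iff_ne.mpr h, h]

theorem cur_of_queried (hs : Consistent v s) {i : Fin I.n} (hi : Queried s i) :
    I.curLo s i = v i ∧ I.curHi s i = v i := by
  induction s with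
  | nil => simp [Queried] at hi
  | cons a s ih =>
    obtain ⟨j, b⟩ := a
    have hb : b = v j := hs (j, b) (by simp)
    rw [curLo_cons, curHi_cons]
    by_cases h : i = j
    · simp [h, hb]
    · simp only [h, if_false]
      exact ih (fun a ha => hs a (by simp [ha])) ((queried_cons.mp hi).resolve_left (Ne.symm h))

theorem cur_of_not_queried {i : Fin I.n} (hi : ¬ Queried s i) :
    I.curLo s i = I.lo i ∧ I.curHi s i = I.hi i := by
  induction s with
  | nil => simp [curLo, curHi]
  | cons a s ih =>
    obtain ⟨j, b⟩ := a
    rw [queried_cons, not_or] at hi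
    rw [curLo_cons, curHi_cons, if_neg (Ne.symm hi.1), if_neg (Ne.symm hi.1)]
    exact ih hi.2

theorem mem_cur (hv : v ∈ I.values) (hs : Consistent v s) (i : Fin I.n) :
    I.curLo s i ≤ v i ∧ v i ≤ I.curHi s i := by
  by_cases hi : Queried s i
  · simp [cur_of_queried hs hi]
  · rw [(cur_of_not_queried hi).1, (cur_of_not_queried hi).2]; exact hv i

theorem adj_of_adj_cons (hv : v ∈ I.values) (hs : Consistent v s) {i j k : Fin I.n}
    (h : (I.depGraph ((i, v i) :: s)).Adj j k) : (I.depGraph s).Adj j k := by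
  obtain ⟨hjk, h₁, h₂⟩ := h
  have hi := mem_cur hv hs i
  simp only [curLo_cons, curHi_cons] at h₁ h₂
  refine ⟨hjk, ?_, ?_⟩ <;> split_ifs at h₁ h₂ <;> subst_vars <;> linarith

theorem adj_cons_iff {i j k : Fin I.n} {a : ℝ} (hj : j ≠ i) (hk : k ≠ i) :
    (I.depGraph ((i, a) :: s)).Adj j k ↔ (I.depGraph s).Adj j k := by
  simp [depGraph, curLo_cons, curHi_cons, hj, hk]

/-- An unqueried item with a dependency. -/
def Active (I : Instance) (s : Transcript I.n) (i : Fin I.n) : Prop :=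
  ¬ Queried s i ∧ ∃ l, (I.depGraph s).Adj i l

theorem Active.of_cons (hv : v ∈ I.values) (hs : Consistent v s) {i k : Fin I.n}
    (h : I.Active ((i, v i) :: s) k) : k ≠ i ∧ I.Active s k := by
  obtain ⟨hq, l, hl⟩ := h
  rw [queried_cons, not_or] at hq
  exact ⟨Ne.symm hq.1, hq.2, l, adj_of_adj_cons hv hs hl⟩

/-- A forced item is unqueried, has a dependency and belongs to every query set. For a revealed
item `j` the interval in the hypothesis is `[v j - δ, v j + δ]`, so both kinds of forced items are
covered. -/
theorem active_and_mem_of_contains_cur (hQ : I.IsQuerySet v Q) (hv : v ∈ I.values)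
    (hs : Consistent v s) {i j : Fin I.n}
    (h : I.StrictlyContains s i (I.curLo s j - I.δ) (I.curHi s j + I.δ)) :
    I.Active s i ∧ i ∈ Q := by
  obtain ⟨h₁, h₂⟩ := h
  have hδ := I.δ_nonneg
  have hj := mem_cur hv hs j
  have hij : i ≠ j := by rintro rfl; linarith
  have hi : ¬ Queried s i := fun hi => by
    rw [(cur_of_queried hs hi).1] at h₁
    rw [(cur_of_queried hs hi).2] at h₂
    linarith
  refine ⟨⟨hi, j, hij, by linarith, by linarith⟩, ?_⟩
  rw [(cur_of_not_queried hi).1] at h₁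
  rw [(cur_of_not_queried hi).2] at h₂
  exact hQ.mem_of_contains_value hv hij (by linarith) (by linarith)

theorem IsForcedByValue.active_and_mem (hQ : I.IsQuerySet v Q) (hv : v ∈ I.values)
    (hs : Consistent v s) {i : Fin I.n} (h : I.IsForcedByValue s i) : I.Active s i ∧ i ∈ Q := by
  obtain ⟨a, ha, h⟩ := h
  have hc := cur_of_queried hs ⟨a, ha, rfl⟩
  refine active_and_mem_of_contains_cur hQ hv hs (j := a.1) ?_
  rwa [hc.1, hc.2, ← hs a ha]

theorem IsForced.active_and_mem (hQ : I.IsQuerySet v Q) (hv : v ∈ I.values)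
    (hs : Consistent v s) {i : Fin I.n} (h : I.IsForced s i) : I.Active s i ∧ i ∈ Q := by
  rcases h with ⟨j, h⟩ | h
  · exact active_and_mem_of_contains_cur hQ hv hs h
  · exact h.active_and_mem hQ hv hs

/-- A dependency of a queried item forces its other end, so that no dependency of a queried item is
left once no item is forced by a value. -/
theorem not_queried_of_adj (hs : Consistent v s) (hf : ∀ i, ¬ I.IsForcedByValue s i)
    {i j : Fin I.n} (h : (I.depGraph s).Adj i j) : ¬ Queried s i := by
  rintro ⟨a, ha, rfl⟩
  have hc := cur_of_queried (I := I) hs ⟨a, ha, rfl⟩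
  obtain ⟨-, h₁, h₂⟩ := h
  rw [hc.2] at h₁
  rw [hc.1] at h₂
  refine hf j ⟨a, ha, ?_, ?_⟩ <;> rw [hs a ha] <;> linarith

theorem active_of_adj (hs : Consistent v s) (hf : ∀ i, ¬ I.IsForcedByValue s i)
    {i j : Fin I.n} (h : (I.depGraph s).Adj i j) : I.Active s i :=
  ⟨not_queried_of_adj hs hf h, j, h⟩

theorem mem_or_mem_of_adj (hQ : I.IsQuerySet v Q) (hv : v ∈ I.values) (hs : Consistent v s)
    (hf : ∀ i, ¬ I.IsForcedByValue s i) {i j : Fin I.n} (h : (I.depGraph s).Adj i j) :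
    i ∈ Q ∨ j ∈ Q := by
  have hi := cur_of_not_queried (I := I) (not_queried_of_adj hs hf h)
  have hj := cur_of_not_queried (I := I) (not_queried_of_adj hs hf h.symm)
  obtain ⟨hij, h₁, h₂⟩ := h
  rw [hi.2, hj.1] at h₁
  rw [hj.2, hi.1] at h₂
  exact hQ.mem_or_mem_of_dependent hv hij h₁ h₂

/-! ### Certified orderings -/

/-- Without dependencies, sorting the current intervals by their midpoints is certified: if `i` has
the smaller midpoint, then `curHi j ≤ curLo i + δ` implies `curHi i ≤ curLo j + δ`. -/
theorem exists_isCertified (h : ∀ i j, ¬ (I.depGraph s).Adj i j) : ∃ π, I.IsCertified s π := by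
  let f : Fin I.n → ℝ := fun i => I.curLo s i + I.curHi s i
  refine ⟨(Tuple.sort f).symm, fun i j hij => ?_⟩
  have hf : f i ≤ f j := by simpa using Tuple.monotone_sort f hij.le
  have hne : i ≠ j := by rintro rfl; exact lt_irrefl _ hij
  by_contra hlt
  refine h i j ⟨hne, by linarith, ?_⟩
  change I.curLo s i + I.curHi s i ≤ I.curLo s j + I.curHi s j at hf
  linarith

theorem IsCertified.isOrdering (hv : v ∈ I.values) (hs : Consistent v s)
    {π : Equiv.Perm (Fin I.n)} (h : I.IsCertified s π) : I.IsOrdering π v := fun i j hij =>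
  (mem_cur hv hs i).2.trans ((h i j hij).trans (by linarith [(mem_cur hv hs j).1]))

theorem finish_queries (tb : TieBreaking I.n) : (I.finish tb s).queries v = [] := by
  unfold finish; split_ifs <;> rfl

theorem finish_isOrdering (tb : TieBreaking I.n) (hv : v ∈ I.values) (hs : Consistent v s)
    (h : ∀ i j, ¬ (I.depGraph s).Adj i j) : I.IsOrdering ((I.finish tb s).result v) v := by
  classical
  unfold finish
  split_ifs with hne
  · refine IsCertified.isOrdering hv hs (s := s) ?_
    exact (Finset.mem_filter.mp (tb.ordering s _ hne).2).2
  · obtain ⟨π, hπ⟩ := exists_isCertified h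
    exact absurd ⟨π, by simpa using hπ⟩ hne

end Instance

/-! ### Program fragments -/

/-- With actual values `v`, the program fragment `t` makes the queries `L` and then passes the
transcript `s'` to its continuation. -/
def LeadsTo {n : ℕ} (v : Fin n → ℝ) (t : (Transcript n → QueryTree n) → QueryTree n)
    (L : List (Fin n)) (s' : Transcript n) : Prop :=
  ∀ k, (t k).queries v = L ++ (k s').queries v ∧ (t k).result v = (k s').result v

open Classical in
/-- The number of items that have not been queried; it bounds the length of every loop. -/
noncomputable def numUnqueried {n : ℕ} (s : Transcript n) : ℕ :=
  (Finset.univ.filter fun i => ¬ Queried s i).card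

theorem numUnqueried_le {n : ℕ} (s : Transcript n) : numUnqueried s ≤ n := by
  classical
  exact (Finset.card_le_univ _).trans (Fintype.card_fin n).le

theorem numUnqueried_cons_le {n : ℕ} (s : Transcript n) (i : Fin n) (a : ℝ) :
    numUnqueried ((i, a) :: s) ≤ numUnqueried s := by
  classical
  refine Finset.card_le_card fun k hk => ?_
  simp only [Finset.mem_filter, queried_cons, not_or] at hk ⊢
  exact ⟨hk.1, hk.2.2⟩

theorem numUnqueried_cons_lt {n : ℕ} {s : Transcript n} {i : Fin n} (hi : ¬ Queried s i) (a : ℝ) :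
    numUnqueried ((i, a) :: s) < numUnqueried s := by
  classical
  refine Finset.card_lt_card ⟨fun k hk => ?_, fun h => ?_⟩
  · simp only [Finset.mem_filter, queried_cons, not_or] at hk ⊢
    exact ⟨hk.1, hk.2.2⟩
  · have := @h i (by simpa using hi)
    simp [queried_cons] at this

theorem numUnqueried_pos {n : ℕ} {s : Transcript n} {i : Fin n} (hi : ¬ Queried s i) :
    0 < numUnqueried s := (Nat.zero_le _).trans_lt (numUnqueried_cons_lt hi 0)

namespace Instance

variable {I : Instance} {v : Fin I.n → ℝ} {s s' : Transcript I.n} {Q : Finset (Fin I.n)}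

/-! ### The potential -/

open Classical in
/-- The number of active items in the query set `Q`: what `Q` still has to pay for the
dependencies that are left. -/
noncomputable def potential (I : Instance) (Q : Finset (Fin I.n)) (s : Transcript I.n) : ℕ :=
  (Q.filter fun i => I.Active s i).card

theorem potential_le_card : I.potential Q s ≤ Q.card := by
  classical
  exact Finset.card_filter_le _ _

theorem potential_add_card_le (T : Finset (Fin I.n)) (hT : ∀ i ∈ T, I.Active s i)
    (h : ∀ i, I.Active s' i → I.Active s i ∧ i ∉ T) :
    I.potential Q s' + (T.filter (· ∈ Q)).card ≤ I.potential Q s := by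
  classical
  unfold potential
  rw [← Finset.card_union_of_disjoint]
  · refine Finset.card_le_card fun k hk => ?_
    simp only [Finset.mem_union, Finset.mem_filter] at hk ⊢
    rcases hk with ⟨hQ, ha⟩ | ⟨hkT, hQ⟩
    · exact ⟨hQ, (h k ha).1⟩
    · exact ⟨hQ, hT k hkT⟩
  · refine Finset.disjoint_left.mpr fun k hk hk' => ?_
    simp only [Finset.mem_filter] at hk hk'
    exact (h k hk.2).2 hk'.1

/-! ### Rounds of the algorithm -/

/-- A `while` loop that queries only active items of `Q` pays for itself. -/
theorem exists_whileForced_leadsTo (tb : TieBreaking I.n) (hv : v ∈ I.values)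
    {P : Transcript I.n → Fin I.n → Prop}
    (hP : ∀ s i, Consistent v s → P s i → I.Active s i ∧ i ∈ Q) (m : ℕ) (s : Transcript I.n)
    (hs : Consistent v s) (hm : numUnqueried s ≤ m) :
    ∃ L s', LeadsTo v (I.whileForced tb P m s) L s' ∧ Consistent v s' ∧ (∀ i, ¬ P s' i) ∧
      numUnqueried s' ≤ numUnqueried s ∧ L.length + I.potential Q s' ≤ I.potential Q s := by
  classical
  induction m generalizing s with
  | zero =>
    refine ⟨[], s, fun k => ⟨rfl, rfl⟩, hs, fun i hi => ?_, le_rfl, by simp⟩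
    have := numUnqueried_pos (hP s i hs hi).1.1
    omega
  | succ m ih =>
    by_cases h : (Finset.univ.filter (P s)).Nonempty
    · obtain ⟨i, hi⟩ : ∃ i, i = (tb.forced s _ h).1 := ⟨_, rfl⟩
      have hPi : P s i := hi ▸ (Finset.mem_filter.mp (tb.forced s _ h).2).2
      obtain ⟨ha, hQ⟩ := hP s i hs hPi
      have hlt := numUnqueried_cons_lt ha.1 (v i)
      obtain ⟨L, s', hL, hs', hP', hle, hpot⟩ :=
        ih ((i, v i) :: s) (consistent_cons hs i) (by omega)
      have hdrop := potential_add_card_le (Q := Q) (s := s) (s' := (i, v i) :: s) {i} (by simpa)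
        (fun k hk => by simpa [and_comm] using Active.of_cons hv hs hk)
      rw [Finset.filter_singleton, if_pos hQ, Finset.card_singleton] at hdrop
      refine ⟨i :: L, s', fun k => ?_, hs', hP', hle.trans hlt.le, ?_⟩
      · rw [whileForced, dif_pos h, ← hi]
        exact ⟨congrArg (i :: ·) (hL k).1, (hL k).2⟩
      · rw [List.length_cons]; omega
    · refine ⟨[], s, fun k => ?_, hs, fun i hi => h ⟨i, by simpa using hi⟩, le_rfl, by simp⟩
      rw [whileForced, dif_neg h]
      exact ⟨rfl, rfl⟩

/-- The loop that ends every round, followed by `k`. -/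
noncomputable def cleanUp (I : Instance) (tb : TieBreaking I.n) (s : Transcript I.n)
    (k : Transcript I.n → QueryTree I.n) : QueryTree I.n :=
  I.whileForced tb I.IsForcedByValue I.n s k

theorem exists_cleanUp_leadsTo (tb : TieBreaking I.n) (hQ : I.IsQuerySet v Q) (hv : v ∈ I.values)
    (hs : Consistent v s) :
    ∃ L s', LeadsTo v (I.cleanUp tb s) L s' ∧ Consistent v s' ∧
      (∀ i, ¬ I.IsForcedByValue s' i) ∧ numUnqueried s' ≤ numUnqueried s ∧
      L.length + I.potential Q s' ≤ I.potential Q s :=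
  exists_whileForced_leadsTo tb hv (fun _ _ hs h => h.active_and_mem hQ hv hs) _ s hs
    (numUnqueried_le s)

open Classical in
/-- A round on the edge component `{i, j}` that queries `i` first, followed by `k`. -/
noncomputable def edgeRound (I : Instance) (tb : TieBreaking I.n) (s : Transcript I.n)
    (i j : Fin I.n) (k : Transcript I.n → QueryTree I.n) : QueryTree I.n :=
  .query i fun vi =>
    if I.StrictlyContains ((i, vi) :: s) j (vi - I.δ) (vi + I.δ) then
      .query j fun vj => I.cleanUp tb ((j, vj) :: (i, vi) :: s) k
    else I.cleanUp tb ((i, vi) :: s) k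

open Classical in
/-- A round on the items `x`, `y`, `z`, followed by `k`. -/
noncomputable def tripleRound (I : Instance) (tb : TieBreaking I.n) (s : Transcript I.n)
    (x y z : Fin I.n) (k : Transcript I.n → QueryTree I.n) : QueryTree I.n :=
  .query y fun vy =>
    if I.StrictlyContains ((y, vy) :: s) x (vy - I.δ) (vy + I.δ) ∨
        (I.depGraph ((y, vy) :: s)).Adj x z then
      .query x fun vx => .query z fun vz => I.cleanUp tb ((z, vz) :: (x, vx) :: (y, vy) :: s) k
    else I.cleanUp tb ((y, vy) :: s) k

/-- If `y` is the only neighbour of `x`, then a query to `y` that does not force `x` isolates `x`. -/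
theorem not_active_of_not_contains (hv : v ∈ I.values) (hs : Consistent v s) {x y : Fin I.n}
    (hx : ∀ l, (I.depGraph s).Adj x l → l = y)
    (h : ¬ I.StrictlyContains ((y, v y) :: s) x (v y - I.δ) (v y + I.δ)) :
    ¬ I.Active ((y, v y) :: s) x := by
  rintro ⟨-, l, hl⟩
  obtain rfl := hx l (adj_of_adj_cons hv hs hl)
  obtain ⟨hne, h₁, h₂⟩ := hl
  rw [curLo_cons, if_pos rfl] at h₁
  rw [curHi_cons, if_pos rfl] at h₂
  exact h ⟨by linarith, by linarith⟩

/-- The two bounds for a round on the edge `{i, j}` that queries `i` first. A query to `j` is paid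
for by `j ∈ Q`, so that the round is too expensive, by at most one query, only if `i ∉ Q`. -/
theorem exists_edgeRound_leadsTo (tb : TieBreaking I.n) (hQ : I.IsQuerySet v Q) (hv : v ∈ I.values)
    (hs : Consistent v s) (hf : ∀ i, ¬ I.IsForcedByValue s i) {i j : Fin I.n}
    (hadj : (I.depGraph s).Adj i j) (hj : ∀ l, (I.depGraph s).Adj j l → l = i) :
    ∃ L s', LeadsTo v (I.edgeRound tb s i j) L s' ∧ Consistent v s' ∧
      (∀ i, ¬ I.IsForcedByValue s' i) ∧ numUnqueried s' < numUnqueried s ∧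
      L.length + I.potential Q s' + (if i ∈ Q then 1 else 0) ≤ I.potential Q s + 1 ∧
      I.potential Q s' + ((if i ∈ Q then 1 else 0) + (if j ∈ Q then 1 else 0)) ≤
        I.potential Q s := by
  classical
  have hai := active_of_adj hs hf hadj
  have haj := active_of_adj hs hf hadj.symm
  have hs₁ := consistent_cons hs i
  have hlt := numUnqueried_cons_lt hai.1 (v i)
  have hT : ∀ k ∈ ({i, j} : Finset (Fin I.n)), I.Active s k := by
    simp [hai, haj]
  have hcard : (({i, j} : Finset (Fin I.n)).filter (· ∈ Q)).card =
      (if i ∈ Q then 1 else 0) + (if j ∈ Q then 1 else 0) := by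
    rw [Finset.card_filter, Finset.sum_pair hadj.ne]
  by_cases hc : I.StrictlyContains ((i, v i) :: s) j (v i - I.δ) (v i + I.δ)
  · have hjQ : j ∈ Q := (IsForcedByValue.active_and_mem hQ hv hs₁ ⟨(i, v i), by simp, hc⟩).2
    obtain ⟨L, s', hL, hs', hf', hle, hpot⟩ :=
      exists_cleanUp_leadsTo tb hQ hv (consistent_cons hs₁ j)
    have hdrop := potential_add_card_le (Q := Q) (s' := (j, v j) :: (i, v i) :: s) {i, j} hT
      (fun k hk => by
        obtain ⟨hkj, hk⟩ := Active.of_cons hv hs₁ hk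
        obtain ⟨hki, hk⟩ := Active.of_cons hv hs hk
        simp [hkj, hki, hk])
    have hle' := numUnqueried_cons_le ((i, v i) :: s) j (v j)
    rw [hcard] at hdrop
    refine ⟨i :: j :: L, s', fun k => ?_, hs', hf', by omega, ?_, by omega⟩
    · simp only [edgeRound, QueryTree.queries, QueryTree.result, if_pos hc]
      exact ⟨congrArg (i :: j :: ·) (hL k).1, (hL k).2⟩
    · rw [if_pos hjQ] at hdrop
      simp only [List.length_cons]
      omega
  · obtain ⟨L, s', hL, hs', hf', hle, hpot⟩ := exists_cleanUp_leadsTo tb hQ hv hs₁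
    have hdrop := potential_add_card_le (Q := Q) (s' := (i, v i) :: s) {i, j} hT
      (fun k hk => by
        have hkj : k ≠ j := by
          rintro rfl
          exact not_active_of_not_contains hv hs hj hc hk
        obtain ⟨hki, hk⟩ := Active.of_cons hv hs hk
        simp [hkj, hki, hk])
    rw [hcard] at hdrop
    refine ⟨i :: L, s', fun k => ?_, hs', hf', by omega, ?_, by omega⟩
    · simp only [edgeRound, QueryTree.queries, QueryTree.result, if_neg hc]
      exact ⟨congrArg (i :: ·) (hL k).1, (hL k).2⟩
    · simp only [List.length_cons]
      omega

/-- By the choice of right endpoints, a triple in which `z` is a neighbour of `x` is a triangle. -/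
theorem IsTriple.adj_y_z {x y z : Fin I.n} (h : I.IsTriple s x y z) :
    (I.depGraph s).Adj y z := by
  obtain ⟨⟨-, hx⟩, ⟨hxy, -⟩, ⟨-, ⟨hxz, hzy⟩, -⟩ | ⟨-, ⟨hyz, -⟩, -⟩⟩ := h
  · have hy := hx y ⟨x, hxy.symm⟩
    have hz := hx z ⟨x, hxz.symm⟩
    obtain ⟨-, hxy, -⟩ := hxy
    obtain ⟨-, hxz, -⟩ := hxz
    exact ⟨hzy.symm, by linarith, by linarith⟩
  · exact hyz

/-- A round on a triple pays for itself at the rate `3 / 2` for every outcome: either one query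
removes `x` and `y` and `Q` meets `{x, y}`, or three queries remove `x`, `y`, `z` and `Q` contains
two of them. -/
theorem exists_tripleRound_leadsTo (tb : TieBreaking I.n) (hQ : I.IsQuerySet v Q)
    (hv : v ∈ I.values) (hs : Consistent v s) (hf : ∀ i, ¬ I.IsForcedByValue s i)
    {x y z : Fin I.n} (h : I.IsTriple s x y z) :
    ∃ L s', LeadsTo v (I.tripleRound tb s x y z) L s' ∧ Consistent v s' ∧
      (∀ i, ¬ I.IsForcedByValue s' i) ∧ numUnqueried s' < numUnqueried s ∧
      2 * L.length + 3 * I.potential Q s' ≤ 3 * I.potential Q s := by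
  classical
  have hyz := h.adj_y_z
  have hxy := h.2.1.1
  have hxz : x ≠ z := by
    obtain ⟨-, -, ⟨-, ⟨hxz, -⟩, -⟩ | ⟨-, ⟨-, hxz⟩, -⟩⟩ := h
    · exact hxz.ne
    · exact hxz.symm
  have hax := active_of_adj hs hf hxy
  have hay := active_of_adj hs hf hyz
  have haz := active_of_adj hs hf hyz.symm
  have hs₁ := consistent_cons hs y
  have hlt := numUnqueried_cons_lt hay.1 (v y)
  have hcover := mem_or_mem_of_adj hQ hv hs hf hxy
  have hcover' := mem_or_mem_of_adj hQ hv hs hf hyz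
  by_cases hc : I.StrictlyContains ((y, v y) :: s) x (v y - I.δ) (v y + I.δ) ∨
      (I.depGraph ((y, v y) :: s)).Adj x z
  · obtain ⟨L, s', hL, hs', hf', hle, hpot⟩ :=
      exists_cleanUp_leadsTo tb hQ hv (consistent_cons (consistent_cons hs₁ x) z)
    have hdrop := potential_add_card_le (Q := Q)
      (s := s) (s' := (z, v z) :: (x, v x) :: (y, v y) :: s) {x, y, z} (by simp [hax, hay, haz])
      (fun k hk => by
        obtain ⟨hkz, hk⟩ := Active.of_cons hv (consistent_cons hs₁ x) hk
        obtain ⟨hkx, hk⟩ := Active.of_cons hv hs₁ hk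
        obtain ⟨hky, hk⟩ := Active.of_cons hv hs hk
        simp [hkx, hky, hkz, hk])
    have h₂ := numUnqueried_cons_le ((y, v y) :: s) x (v x)
    have h₃ := numUnqueried_cons_le ((x, v x) :: (y, v y) :: s) z (v z)
    have htwo : 2 ≤ (({x, y, z} : Finset (Fin I.n)).filter (· ∈ Q)).card := by
      rw [Finset.card_filter, Finset.sum_insert (by simp [hxy.ne, hxz]),
        Finset.sum_pair hyz.ne]
      -- Either `x` is forced and `Q` covers the edge `yz`, or `x`, `y`, `z` form a triangle.
      rcases hc with hc | hc
      · have hxQ : x ∈ Q :=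
          (IsForcedByValue.active_and_mem hQ hv hs₁ ⟨(y, v y), by simp, hc⟩).2
        rcases hcover' with h' | h' <;> simp [hxQ, h'] <;> omega
      · have := mem_or_mem_of_adj hQ hv hs hf (adj_of_adj_cons hv hs hc)
        split_ifs <;> first | omega | tauto
    refine ⟨y :: x :: z :: L, s', fun k => ?_, hs', hf', by omega, ?_⟩
    · simp only [tripleRound, QueryTree.queries, QueryTree.result, if_pos hc]
      exact ⟨congrArg (y :: x :: z :: ·) (hL k).1, (hL k).2⟩
    · simp only [List.length_cons]
      omega
  · rw [not_or, adj_cons_iff hxy.ne hyz.ne.symm] at hc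
    -- As `x` and `z` are independent, the triple is of the second kind: `x` is a leaf.
    have hleaf : ∀ l, (I.depGraph s).Adj x l → l = y := by
      obtain ⟨-, -, ⟨-, ⟨hxz, -⟩, -⟩ | ⟨hN, -⟩⟩ := h
      · exact absurd hxz hc.2
      · exact fun l hl => by simpa [hN] using (show l ∈ (I.depGraph s).neighborSet x from hl)
    obtain ⟨L, s', hL, hs', hf', hle, hpot⟩ := exists_cleanUp_leadsTo tb hQ hv hs₁
    have hdrop := potential_add_card_le (Q := Q) (s := s) (s' := (y, v y) :: s) {x, y}
      (by simp [hax, hay]) (fun k hk => by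
        have hkx : k ≠ x := by
          rintro rfl
          exact not_active_of_not_contains hv hs hleaf hc.1 hk
        obtain ⟨hky, hk⟩ := Active.of_cons hv hs hk
        simp [hkx, hky, hk])
    have hone : 1 ≤ (({x, y} : Finset (Fin I.n)).filter (· ∈ Q)).card := by
      rw [Finset.card_filter, Finset.sum_pair hxy.ne]
      rcases hcover with h' | h' <;> simp [h']
    refine ⟨y :: L, s', fun k => ?_, hs', hf', by omega, ?_⟩
    · have hc' : ¬ (I.StrictlyContains ((y, v y) :: s) x (v y - I.δ) (v y + I.δ) ∨
          (I.depGraph ((y, v y) :: s)).Adj x z) := by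
        rw [not_or, adj_cons_iff hxy.ne hyz.ne.symm]; exact hc
      simp only [tripleRound, QueryTree.queries, QueryTree.result, if_neg hc']
      exact ⟨congrArg (y :: ·) (hL k).1, (hL k).2⟩
    · simp only [List.length_cons]
      omega

/-! ### The main loop -/

theorem exists_isMinRight {P : Fin I.n → Prop} (h : ∃ k, P k) : ∃ x, I.IsMinRight s P x := by
  classical
  obtain ⟨k, hk⟩ := h
  obtain ⟨x, hx, hmin⟩ := Finset.exists_min_image (Finset.univ.filter P) (I.curHi s)
    ⟨k, by simpa using hk⟩
  exact ⟨x, by simpa using hx, fun l hl => hmin l (by simpa using hl)⟩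

/-- A vertex with a neighbour `j` that is not its only one has another neighbour. -/
theorem exists_adj_ne {i j : Fin I.n} (h : (I.depGraph s).Adj i j)
    (hN : (I.depGraph s).neighborSet i ≠ {j}) : ∃ k, (I.depGraph s).Adj i k ∧ k ≠ j := by
  by_contra! hall
  exact hN (Set.eq_singleton_iff_unique_mem.mpr ⟨h, fun k hk => hall k hk⟩)

theorem exists_isTriple (hdep : ∃ i j, (I.depGraph s).Adj i j)
    (he : ∀ i j, ¬ I.IsEdgeComponent s i j) : ∃ x y z, I.IsTriple s x y z := by
  obtain ⟨x, hx⟩ := exists_isMinRight (s := s) hdep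
  obtain ⟨y, hy⟩ := exists_isMinRight (s := s) hx.1
  by_cases hN : (I.depGraph s).neighborSet x = {y}
  · obtain ⟨z, hz⟩ := exists_isMinRight (s := s)
      (exists_adj_ne hy.1.symm fun hN' => he x y ⟨hN, hN'⟩)
    exact ⟨x, y, z, hx, hy, Or.inr ⟨hN, hz⟩⟩
  · obtain ⟨z, hz⟩ := exists_isMinRight (s := s) (exists_adj_ne hy.1 hN)
    exact ⟨x, y, z, hx, hy, Or.inl ⟨hN, hz⟩⟩

/-- One round of the main loop, for both outcomes `b` of its coin. The last inequality says that
the average number of queries is at most `3 / 2` times the average drop of the potential. -/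
theorem exists_mainLoop_round (tb : TieBreaking I.n) (hQ : I.IsQuerySet v Q) (hv : v ∈ I.values)
    (hs : Consistent v s) (hf : ∀ i, ¬ I.IsForcedByValue s i)
    (hdep : ∃ i j, (I.depGraph s).Adj i j) :
    ∃ (L : Bool → List (Fin I.n)) (s' : Bool → Transcript I.n),
      (∀ m (coin : Fin (m + 1) → Bool),
        (I.mainLoop tb (m + 1) coin s).queries v =
          L (coin 0) ++ (I.mainLoop tb m (Fin.tail coin) (s' (coin 0))).queries v ∧
        (I.mainLoop tb (m + 1) coin s).result v =
          (I.mainLoop tb m (Fin.tail coin) (s' (coin 0))).result v) ∧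
      (∀ b, Consistent v (s' b) ∧ (∀ i, ¬ I.IsForcedByValue (s' b) i) ∧
        numUnqueried (s' b) < numUnqueried s) ∧
      2 * ((L true).length + (L false).length) +
        3 * (I.potential Q (s' true) + I.potential Q (s' false)) ≤ 6 * I.potential Q s := by
  classical
  by_cases he : (Finset.univ.filter fun e : Fin I.n × Fin I.n =>
      I.IsEdgeComponent s e.1 e.2).Nonempty
  · obtain ⟨e, he'⟩ : ∃ e, e = (tb.edge s _ he).1 := ⟨_, rfl⟩
    have hedge : I.IsEdgeComponent s e.1 e.2 :=
      he' ▸ (Finset.mem_filter.mp (tb.edge s _ he).2).2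
    have hadj : (I.depGraph s).Adj e.1 e.2 := by
      have : e.2 ∈ (I.depGraph s).neighborSet e.1 := by simp [hedge.1]
      exact this
    have h₁ : ∀ l, (I.depGraph s).Adj e.1 l → l = e.2 := fun l hl => by
      simpa [hedge.1] using (show l ∈ (I.depGraph s).neighborSet e.1 from hl)
    have h₂ : ∀ l, (I.depGraph s).Adj e.2 l → l = e.1 := fun l hl => by
      simpa [hedge.2] using (show l ∈ (I.depGraph s).neighborSet e.2 from hl)
    obtain ⟨Lt, st, hLt, hst, hft, hmt, hpt, hpt'⟩ :=
      exists_edgeRound_leadsTo tb hQ hv hs hf hadj h₂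
    obtain ⟨Lf, sf, hLf, hsf, hff, hmf, hpf, hpf'⟩ :=
      exists_edgeRound_leadsTo tb hQ hv hs hf hadj.symm h₁
    have hcover := mem_or_mem_of_adj hQ hv hs hf hadj
    refine ⟨fun b => if b then Lt else Lf, fun b => if b then st else sf, fun m coin => ?_,
      fun b => ?_, ?_⟩
    · have hround : I.mainLoop tb (m + 1) coin s =
          I.edgeRound tb s (if coin 0 then e.1 else e.2) (if coin 0 then e.2 else e.1)
            (I.mainLoop tb m (Fin.tail coin)) := by
        subst he'
        simp only [mainLoop]
        rw [if_pos hdep, dif_pos he]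
        rfl
      rw [hround]
      cases coin 0
      · exact hLf _
      · exact hLt _
    · cases b
      · exact ⟨hsf, hff, hmf⟩
      · exact ⟨hst, hft, hmt⟩
    -- Adding the bounds for both orders, `i ∈ Q` and `j ∈ Q` cancel the overspending.
    · have hone : 1 ≤ (if e.1 ∈ Q then 1 else 0) + (if e.2 ∈ Q then 1 else 0) := by
        rcases hcover with h | h <;> simp [h]
      simp only [if_true, Bool.false_eq_true, if_false]
      omega
  · have he' : ∀ i j, ¬ I.IsEdgeComponent s i j := fun i j h => he ⟨(i, j), by simpa using h⟩
    have ht : (Finset.univ.filter fun t : Fin I.n × Fin I.n × Fin I.n =>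
        I.IsTriple s t.1 t.2.1 t.2.2).Nonempty := by
      obtain ⟨x, y, z, h⟩ := exists_isTriple hdep he'
      exact ⟨(x, y, z), by simpa using h⟩
    obtain ⟨t, ht'⟩ : ∃ t, t = (tb.triple s _ ht).1 := ⟨_, rfl⟩
    have htriple : I.IsTriple s t.1 t.2.1 t.2.2 :=
      ht' ▸ (Finset.mem_filter.mp (tb.triple s _ ht).2).2
    obtain ⟨L, s', hL, hs', hf', hm, hp⟩ := exists_tripleRound_leadsTo tb hQ hv hs hf htriple
    refine ⟨fun _ => L, fun _ => s', fun m coin => ?_, fun _ => ⟨hs', hf', hm⟩, ?_⟩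
    · have hround : I.mainLoop tb (m + 1) coin s =
          I.tripleRound tb s t.1 t.2.1 t.2.2 (I.mainLoop tb m (Fin.tail coin)) := by
        subst ht'
        simp only [mainLoop]
        rw [if_pos hdep, dif_neg he, dif_pos ht]
        rfl
      rw [hround]
      exact hL _
    · dsimp only
      omega

theorem mainLoop_of_not_dependent (tb : TieBreaking I.n) (h : ∀ i j, ¬ (I.depGraph s).Adj i j)
    (m : ℕ) (coin : Fin m → Bool) : I.mainLoop tb m coin s = I.finish tb s := by
  classical
  cases m with
  | zero => rfl
  | succ m =>
    simp only [mainLoop]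
    exact if_neg fun ⟨i, j, hij⟩ => h i j hij

/-- Every round queries an unqueried item, so `m` coins suffice to remove all dependencies. -/
theorem mainLoop_isOrdering (tb : TieBreaking I.n) (hQ : I.IsQuerySet v Q) (hv : v ∈ I.values)
    (m : ℕ) (coin : Fin m → Bool) (s : Transcript I.n) (hs : Consistent v s)
    (hf : ∀ i, ¬ I.IsForcedByValue s i) (hm : numUnqueried s ≤ m) :
    I.IsOrdering ((I.mainLoop tb m coin s).result v) v := by
  by_cases hdep : ∃ i j, (I.depGraph s).Adj i j
  · induction m generalizing s with
    | zero =>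
      obtain ⟨i, j, hij⟩ := hdep
      have := numUnqueried_pos (not_queried_of_adj hs hf hij)
      omega
    | succ m ih =>
      obtain ⟨L, s', hL, hs', -⟩ := exists_mainLoop_round tb hQ hv hs hf hdep
      obtain ⟨hc, hf', hlt⟩ := hs' (coin 0)
      rw [(hL m coin).2]
      by_cases hdep' : ∃ i j, (I.depGraph (s' (coin 0))).Adj i j
      · exact ih _ _ hc hf' (by omega) hdep'
      · push Not at hdep'
        rw [mainLoop_of_not_dependent tb hdep']
        exact finish_isOrdering tb hv hc hdep'
  · push Not at hdep
    rw [mainLoop_of_not_dependent tb hdep]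
    exact finish_isOrdering tb hv hs hdep

/-- The left side is `2 * 2 ^ m` times the expected number of queries with `m` fair coins. -/
theorem sum_mainLoop_length_le (tb : TieBreaking I.n) (hQ : I.IsQuerySet v Q) (hv : v ∈ I.values)
    (m : ℕ) (s : Transcript I.n) (hs : Consistent v s)
    (hf : ∀ i, ¬ I.IsForcedByValue s i) :
    2 * ∑ coin : Fin m → Bool, ((I.mainLoop tb m coin s).queries v).length ≤
      3 * 2 ^ m * I.potential Q s := by
  induction m generalizing s with
  | zero => simp [mainLoop, finish_queries]
  | succ m ih =>
    by_cases hdep : ∃ i j, (I.depGraph s).Adj i j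
    · obtain ⟨L, s', hL, hs', hp⟩ := exists_mainLoop_round tb hQ hv hs hf hdep
      have hsum : ∑ coin : Fin (m + 1) → Bool,
          ((I.mainLoop tb (m + 1) coin s).queries v).length =
          ∑ b : Bool, ∑ coin : Fin m → Bool,
            ((L b).length + ((I.mainLoop tb m coin (s' b)).queries v).length) := by
        rw [← (Fin.consEquiv fun _ => Bool).sum_comp, Fintype.sum_prod_type]
        refine Finset.sum_congr rfl fun b _ => Finset.sum_congr rfl fun coin _ => ?_
        rw [(hL m _).1]
        simp [Fin.consEquiv]
      have ht := ih (s' true) (hs' true).1 (hs' true).2.1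
      have hff := ih (s' false) (hs' false).1 (hs' false).2.1
      have hmul := Nat.mul_le_mul_left (2 ^ m) hp
      rw [hsum, Fintype.sum_bool]
      simp only [Finset.sum_add_distrib, Finset.sum_const, Finset.card_univ, Fintype.card_pi,
        Fintype.card_bool, Finset.prod_const, Fintype.card_fin, smul_eq_mul]
      rw [pow_succ]
      nlinarith
    · push Not at hdep
      simp [mainLoop_of_not_dependent tb hdep, finish_queries]

/-! ### The whole algorithm -/

theorem isQuerySet_univ : I.IsQuerySet v Finset.univ := by
  refine ⟨(Tuple.sort v).symm, fun u _ huv i j hij => ?_⟩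
  have : v i ≤ v j := by simpa using Tuple.monotone_sort v hij.le
  rw [huv i (Finset.mem_univ i), huv j (Finset.mem_univ j)]
  linarith [I.δ_nonneg]

theorem exists_firstLoop_leadsTo (tb : TieBreaking I.n) (hQ : I.IsQuerySet v Q)
    (hv : v ∈ I.values) :
    ∃ L s', LeadsTo v (I.whileForced tb I.IsForced I.n []) L s' ∧ Consistent v s' ∧
      (∀ i, ¬ I.IsForcedByValue s' i) ∧ L.length + I.potential Q s' ≤ Q.card := by
  obtain ⟨L, s', hL, hs', hf, -, hp⟩ := exists_whileForced_leadsTo (P := I.IsForced) tb hv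
    (fun _ _ hs h => h.active_and_mem hQ hv hs) I.n [] consistent_nil (numUnqueried_le _)
  exact ⟨L, s', hL, hs', fun i hi => hf i (Or.inr hi), hp.trans potential_le_card⟩

theorem adaptiveTree_isOrdering (tb : TieBreaking I.n) (hv : v ∈ I.values)
    (coin : Fin I.n → Bool) : I.IsOrdering ((I.adaptiveTree tb coin).result v) v := by
  obtain ⟨L, s', hL, hs', hf, -⟩ := exists_firstLoop_leadsTo tb isQuerySet_univ hv
  rw [adaptiveTree, (hL _).2]
  exact mainLoop_isOrdering tb isQuerySet_univ hv _ coin s' hs' hf (numUnqueried_le _)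

theorem sum_adaptiveTree_length_le (tb : TieBreaking I.n) (hQ : I.IsQuerySet v Q)
    (hv : v ∈ I.values) :
    2 * ∑ coin : Fin I.n → Bool, ((I.adaptiveTree tb coin).queries v).length ≤
      3 * 2 ^ I.n * Q.card := by
  obtain ⟨L, s', hL, hs', hf, hp⟩ := exists_firstLoop_leadsTo tb hQ hv
  have hmain := sum_mainLoop_length_le tb hQ hv I.n s' hs' hf
  have hmul := Nat.mul_le_mul_left (2 ^ I.n) hp
  have hsum : ∑ coin : Fin I.n → Bool, ((I.adaptiveTree tb coin).queries v).length =
      2 ^ I.n * L.length +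
        ∑ coin : Fin I.n → Bool, ((I.mainLoop tb I.n coin s').queries v).length := by
    simp [adaptiveTree, (hL _).1, Finset.sum_add_distrib]
  rw [hsum]
  linarith [Nat.zero_le (2 ^ I.n * L.length)]

end Instance

/-! ### The competitive ratio of the algorithm -/

theorem sum_map_cost {I : Instance} {c : ℝ≥0} (hI : ∀ i, I.cost i = c) (l : List (Fin I.n)) :
    (l.map fun i => (I.cost i : ℝ≥0∞)).sum = ((l.length * c : ℝ≥0) : ℝ≥0∞) := by
  simp [hI]

theorem fairCoin_singleton (h : (1 / 2 : ℝ) ∈ unitInterval) (b : Bool) :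
    bernoulliMeasure true false (⟨1 / 2, h⟩ : unitInterval) {b} = ((1 / 2 : ℝ≥0) : ℝ≥0∞) := by
  classical
  rw [bernoulliMeasure_apply _ (measurableSet_singleton b)]
  have hhalf : unitInterval.toNNReal ⟨1 / 2, h⟩ = 1 / 2 := by ext; simp
  have hhalf' : unitInterval.toNNReal (unitInterval.symm ⟨1 / 2, h⟩) = 1 / 2 := by
    ext; simp; norm_num
  rw [hhalf, hhalf']
  cases b <;> simp

theorem improvedAdaptive_expectedCost_le (h : (1 / 2 : ℝ) ∈ unitInterval)
    (tb : (I : Instance) → TieBreaking I.n) {I : Instance} {c : ℝ≥0} (hI : ∀ i, I.cost i = c)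
    {v : Fin I.n → ℝ} (hv : v ∈ I.values) {Q : Finset (Fin I.n)} (hQ : I.IsQuerySet v Q) :
    (improvedAdaptive ⟨1 / 2, h⟩ tb).expectedCost I v ≤
      ((3 / 2 : ℝ≥0) : ℝ≥0∞) * ∑ i ∈ Q, (I.cost i : ℝ≥0∞) := by
  have hlen := Instance.sum_adaptiveTree_length_le (tb I) hQ hv
  have hsum : (improvedAdaptive ⟨1 / 2, h⟩ tb).expectedCost I v =
      (((∑ coin : Fin I.n → Bool, ((I.adaptiveTree (tb I) coin).queries v).length : ℕ) * c *
        (1 / 2) ^ I.n : ℝ≥0) : ℝ≥0∞) := by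
    change ∫⁻ coin : Fin I.n → Bool, (((I.adaptiveTree (tb I) coin).queries v).map
      fun i => (I.cost i : ℝ≥0∞)).sum ∂(Measure.pi fun _ => bernoulliMeasure true false
        (⟨1 / 2, h⟩ : unitInterval)) = _
    rw [lintegral_fintype]
    simp only [sum_map_cost hI, Measure.pi_singleton, fairCoin_singleton, Finset.prod_const,
      Finset.card_univ, Fintype.card_fin]
    push_cast
    rw [Finset.sum_mul, Finset.sum_mul]
  have hcost : ∑ i ∈ Q, (I.cost i : ℝ≥0∞) = ((Q.card * c : ℝ≥0) : ℝ≥0∞) := by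
    simp [hI]
  rw [hsum, hcost, ← ENNReal.coe_mul, ENNReal.coe_le_coe]
  generalize ∑ coin : Fin I.n → Bool, ((I.adaptiveTree (tb I) coin).queries v).length = N at hlen
  have hlen' : (2 : ℝ≥0) * N ≤ 3 * 2 ^ I.n * Q.card := by exact_mod_cast hlen
  calc (N : ℝ≥0) * c * (1 / 2) ^ I.n = (2 * N) * (c * (1 / 2) ^ I.n / 2) := by ring
    _ ≤ (3 * 2 ^ I.n * Q.card) * (c * (1 / 2) ^ I.n / 2) := by gcongr
    _ = 3 / 2 * (Q.card * c) * (2 * (1 / 2)) ^ I.n := by rw [mul_pow]; ring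
    _ = 3 / 2 * (Q.card * c) := by norm_num

theorem improvedAdaptive_solvesOn (p : unitInterval) (tb : (I : Instance) → TieBreaking I.n)
    (S : Set Instance) : (improvedAdaptive p tb).SolvesOn S := fun I _ _ hv =>
  Filter.Eventually.of_forall fun coin => Instance.adaptiveTree_isOrdering (tb I) hv coin

theorem improvedAdaptive_isCompetitiveOn (h : (1 / 2 : ℝ) ∈ unitInterval)
    (tb : (I : Instance) → TieBreaking I.n) (δ : ℝ) (c : ℝ≥0) :
    (improvedAdaptive ⟨1 / 2, h⟩ tb).IsCompetitiveOn (uniformInstances δ c) (3 / 2) := by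
  intro I hI v hv
  have hne : ((3 / 2 : ℝ≥0) : ℝ≥0∞) ≠ 0 := by
    rw [ENNReal.coe_ne_zero]; positivity
  simp only [Instance.opt, ENNReal.mul_iInf_of_ne hne ENNReal.coe_ne_top]
  exact le_iInf₂ fun Q hQ => improvedAdaptive_expectedCost_le h tb hI.2 hv hQ

/-! ### The lower bound -/

theorem QueryTree.result_update_of_notMem {n : ℕ} (T : QueryTree n) {v : Fin n → ℝ} {i : Fin n}
    (hi : i ∉ T.queries v) (a : ℝ) : T.result (Function.update v i a) = T.result v := by
  induction T with
  | output π => rfl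
  | query k next ih =>
    simp only [queries, List.mem_cons, not_or] at hi
    simp only [result, Function.update_of_ne (Ne.symm hi.1)]
    exact ih _ hi.2

theorem RandomizedStrategy.measurable_comp_queries {n : ℕ} (R : RandomizedStrategy n)
    (v : Fin n → ℝ) (g : List (Fin n) → ℝ≥0∞) : Measurable fun ω => g ((R.tree ω).queries v) := by
  intro t _
  have : (fun ω => g ((R.tree ω).queries v)) ⁻¹' t =
      ⋃ l ∈ g ⁻¹' t, {ω | (R.tree ω).queries v = l} := by
    ext ω; simp
  rw [this]
  exact MeasurableSet.biUnion (Set.to_countable _) fun l _ => R.measurable_queries v l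

theorem RandomizedAlgorithm.le_expectedCost_add_expectedCost (A : RandomizedAlgorithm)
    {I : Instance} {c : ℝ≥0} (hI : ∀ i, I.cost i = c) {u v : Fin I.n → ℝ} {m : ℕ}
    (h : ∀ᵐ ω ∂(A I).μ,
      m ≤ (((A I).tree ω).queries u).length + (((A I).tree ω).queries v).length) :
    ((m * c : ℝ≥0) : ℝ≥0∞) ≤ A.expectedCost I u + A.expectedCost I v := by
  have hmeas := (A I).measurable_comp_queries u fun l => (l.map fun i => (I.cost i : ℝ≥0∞)).sum
  calc ((m * c : ℝ≥0) : ℝ≥0∞) = ∫⁻ _, ((m * c : ℝ≥0) : ℝ≥0∞) ∂(A I).μ := by simp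
    _ ≤ _ := lintegral_mono_ae ?_
    _ = _ := lintegral_add_left hmeas _
  filter_upwards [h] with ω hω
  rw [sum_map_cost hI, sum_map_cost hI, ← ENNReal.coe_add, ENNReal.coe_le_coe, ← add_mul]
  gcongr
  exact_mod_cast hω

/-- Two copies of the interval `[0, 2δ + 2]`. Its midpoint `δ + 1` is more than `δ` away from both
endpoints. -/
abbrev twinInstance (δ : ℝ) (hδ : 0 ≤ δ) (c : ℝ≥0) : Instance where
  n := 2
  lo _ := 0
  hi _ := 2 * δ + 2
  lo_le_hi _ := by positivity
  cost _ := c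
  δ := δ
  δ_nonneg := hδ

/-- Item `k` has value `0` and the other one has the midpoint value. Querying `k` alone proves an
ordering, and querying the other item alone does not. -/
def twinValues (δ : ℝ) (k : Fin 2) : Fin 2 → ℝ := fun i => if i = k then 0 else δ + 1

theorem twinValues_mem {δ : ℝ} (hδ : 0 ≤ δ) (c : ℝ≥0) (k : Fin 2) :
    twinValues δ k ∈ (twinInstance δ hδ c).values := by
  intro i
  change (if i = k then 0 else δ + 1) ∈ Set.Icc 0 (2 * δ + 2)
  split_ifs <;> constructor <;> linarith

theorem opt_twinInstance_le {δ : ℝ} (hδ : 0 ≤ δ) (c : ℝ≥0) (k : Fin 2) :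
    (twinInstance δ hδ c).opt (twinValues δ k) ≤ c := by
  refine (iInf₂_le ({k} : Finset (Fin 2)) ?_).trans ?_
  · refine ⟨Equiv.swap (0 : Fin 2) k, fun u hu huk i j hij => ?_⟩
    have hk : u k = 0 := by
      have := huk k (Finset.mem_singleton_self k)
      simpa [twinValues] using this
    have hik : i = k := by
      by_contra hik
      have hjk : j = k := by
        have hne : i ≠ j := by rintro rfl; exact lt_irrefl _ hij
        exact (by decide : ∀ i j k : Fin 2, i ≠ k → i ≠ j → j = k) i j k hik hne
      rw [hjk, Equiv.swap_apply_right] at hij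
      exact absurd hij (Fin.not_lt_zero _)
    subst hik
    have := (hu j).1
    change 0 ≤ u j at this
    change u i ≤ u j + δ
    linarith
  · rw [Finset.sum_singleton]

/-- A tree that copes with both extreme values of `k` must query `k`. -/
theorem mem_queries_of_isOrdering {δ : ℝ} (hδ : 0 ≤ δ) (c : ℝ≥0) (k : Fin 2) (T : QueryTree 2)
    (h : (twinInstance δ hδ c).IsOrdering (T.result (twinValues δ k)) (twinValues δ k))
    (h' : (twinInstance δ hδ c).IsOrdering
      (T.result (Function.update (twinValues δ k) k (2 * δ + 2)))
      (Function.update (twinValues δ k) k (2 * δ + 2))) :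
    k ∈ T.queries (twinValues δ k) := by
  by_contra hk
  rw [T.result_update_of_notMem hk] at h'
  obtain ⟨j, hj⟩ := exists_ne k
  have h₁ : twinValues δ k k = 0 := by simp [twinValues]
  have h₂ : twinValues δ k j = δ + 1 := by simp [twinValues, hj]
  rcases lt_or_gt_of_ne ((T.result (twinValues δ k)).injective.ne hj) with hlt | hlt
  · have := h j k hlt
    rw [h₁, h₂] at this
    change δ + 1 ≤ 0 + δ at this
    linarith
  · have := h' k j hlt
    rw [Function.update_self, Function.update_of_ne hj, h₂] at this
    change 2 * δ + 2 ≤ δ + 1 + δ at this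
    linarith

/-- The item that is queried first does not depend on the values, and it is the wrong one for one
of the two value vectors. -/
theorem three_le_length_add_length {δ : ℝ} (T : QueryTree 2)
    (h : ∀ k, k ∈ T.queries (twinValues δ k)) :
    3 ≤ (T.queries (twinValues δ 0)).length + (T.queries (twinValues δ 1)).length := by
  cases T with
  | output π => simpa [QueryTree.queries] using h 0
  | query i next =>
    simp only [QueryTree.queries, List.mem_cons, List.length_cons] at h ⊢
    have h0 := h 0
    have h1 := h 1
    fin_cases i
    · have := List.length_pos_of_mem (h1.resolve_left (by simp))
      simp only [Fin.zero_eta] at this ⊢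
      omega
    · have := List.length_pos_of_mem (h0.resolve_left (by simp))
      simp only [Fin.mk_one] at this ⊢
      omega

theorem three_halves_le_of_isCompetitiveOn {δ : ℝ} (hδ : 0 ≤ δ) {c : ℝ≥0} (hc : 0 < c)
    (A : RandomizedAlgorithm) (α : ℝ≥0) (hA : A.SolvesOn (uniformInstances δ c))
    (hα : A.IsCompetitiveOn (uniformInstances δ c) α) : 3 / 2 ≤ α := by
  have hI : twinInstance δ hδ c ∈ uniformInstances δ c := ⟨rfl, fun _ => rfl⟩
  have hmem : ∀ k, ∀ᵐ ω ∂(A (twinInstance δ hδ c)).μ,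
      k ∈ ((A (twinInstance δ hδ c)).tree ω).queries (twinValues δ k) := fun k => by
    have hv := twinValues_mem hδ c k
    have hv' : Function.update (twinValues δ k) k (2 * δ + 2) ∈ (twinInstance δ hδ c).values :=
      Instance.values_update hv (Set.right_mem_Icc.mpr ((twinInstance δ hδ c).lo_le_hi k))
    filter_upwards [hA _ hI _ hv, hA _ hI _ hv'] with ω h h'
    exact mem_queries_of_isOrdering hδ c k _ h h'
  have hle : ∀ k, A.expectedCost (twinInstance δ hδ c) (twinValues δ k) ≤ α * c := fun k =>
    (hα _ hI _ (twinValues_mem hδ c k)).trans (mul_le_mul_right (opt_twinInstance_le hδ c k) _)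
  have hsum : (((3 : ℕ) * c : ℝ≥0) : ℝ≥0∞) ≤
      A.expectedCost (twinInstance δ hδ c) (twinValues δ 0) +
        A.expectedCost (twinInstance δ hδ c) (twinValues δ 1) := by
    refine A.le_expectedCost_add_expectedCost hI.2 ?_
    filter_upwards [hmem 0, hmem 1] with ω h0 h1
    exact three_le_length_add_length _ (fun k => by fin_cases k; exacts [h0, h1])
  have hfinal : 3 * c ≤ α * c + α * c := by
    exact_mod_cast hsum.trans (add_le_add (hle 0) (hle 1))
  have h2 : 3 ≤ 2 * α := le_of_mul_le_mul_right (by linarith : 3 * c ≤ 2 * α * c) hc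
  rw [div_le_iff₀ (by norm_num)]
  linarith

end SortingQueries

open SortingQueries in
theorem mainTheorem1 (δ : ℝ) (hδ : 0 ≤ δ) (c : NNReal) (hc : 0 < c) :
    (∀ tb : (I : Instance) → TieBreaking I.n,
      (improvedAdaptive ⟨1 / 2, by norm_num, by norm_num⟩ tb).SolvesOn (uniformInstances δ c) ∧
      (improvedAdaptive ⟨1 / 2, by norm_num, by norm_num⟩ tb).IsCompetitiveOn
        (uniformInstances δ c) (3 / 2)) ∧
    (∀ (A : RandomizedAlgorithm) (α : NNReal),
      A.SolvesOn (uniformInstances δ c) → A.IsCompetitiveOn (uniformInstances δ c) α →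
        3 / 2 ≤ α) :=
  ⟨fun tb => ⟨improvedAdaptive_solvesOn _ tb _, improvedAdaptive_isCompetitiveOn _ tb δ c⟩,
    fun A α hA hα => three_halves_le_of_isCompetitiveOn hδ hc A α hA hα⟩
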